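/- Let $d\ge 2$ and $Y=[0,1]^d$; a function on $\mathbb R^d$ is $Y$-periodic if it is invariant under translation by every vector of $\mathbb Z^d$. Let $u\in C^3(\mathbb R^d)$ be a real-valued function whose gradient $\nabla u$ is $Y$-periodic, and let $X$ be its gradient flow: for each $x\in\mathbb R^d$, $X(\cdot,x)$ is the unique solution on $\mathbb R$ of $$X'(t,x)=\nabla u\big(X(t,x)\big),\qquad X(0,x)=x .$$ Assume that for almost every $x\in\mathbb R^d$ at least one of the trajectories $X([0,\infty),x)$ and $X((-\infty,0],x)$ is bounded in $\mathbb R^d$. Say that $\nabla u$ is isotropically realizable in the torus with the positive conductivity $\sigma$ if $\sigma:\mathbb R^d\to(0,\infty)$ is locally integrable and $Y$-periodic and $\operatorname{div}(\sigma\nabla u)=0$ in the sense of distributions on $\mathbb R^d$. Consider the two conditions (a) for every $x\in\mathbb R^d$, $\nabla u(x)=0$ implies $\Delta u(x)=0$; (b) there is a constant $C>0$ such that $\left|\int_0^t\Delta u\big(X(s,x)\big)\,ds\right|\le C$ for all $t\ge 0$ and all $x\in\mathbb R^d$. (i) If (a) and (b) hold, then $\nabla u$ is isotropically realizable in the torus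 with a positive conductivity $\sigma$ such that $\sigma$ and $\sigma^{-1}$ belong to $L^\infty(\mathbb R^d)$. (ii) Conversely, if $\nabla u$ is isotropically realizable in the torus with a positive conductivity $\sigma$ of class $C^1$ on $\mathbb R^d$, then (a) and (b) hold. -/

import Mathlib

open MeasureTheory Set
open scoped Gradient Laplacian ContDiff NNReal InnerProductSpace Manifold

/-- `Y`-periodicity, `Y = [0,1]^d` being the unit cube: invariance under translation by every
vector with integer coordinates. -/
def IsYPeriodic {d : ℕ} {β : Type*} (f : EuclideanSpace ℝ (Fin d) → β) : Prop :=
  ∀ k : Fin d → ℤ, Function.Periodic f (WithLp.toLp 2 fun i => (k i : ℝ))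

open Classical in
/-- The gradient flow `X(t,x)` of `u`: the value at time `t` of the solution on the whole of `ℝ` of
`X' = ∇u(X)`, `X(0) = x`. The default value is used only if there is no such solution; for `u` of
class `C²` with a periodic gradient this never happens, and the solution is unique, see
`gradientFlow_spec` and `eq_gradientFlow`. -/
noncomputable def gradientFlow {d : ℕ} (u : EuclideanSpace ℝ (Fin d) → ℝ) (t : ℝ)
    (x : EuclideanSpace ℝ (Fin d)) : EuclideanSpace ℝ (Fin d) :=
  if h : ∃ γ : ℝ → EuclideanSpace ℝ (Fin d), γ 0 = x ∧ IsIntegralCurve γ (fun _ => ∇ u)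
  then h.choose t else x

/-- `div (σ ∇u) = 0` in the sense of distributions on `ℝ^d`. -/
def DivSigmaGradEqZero {d : ℕ} (σ u : EuclideanSpace ℝ (Fin d) → ℝ) : Prop :=
  ∀ φ : EuclideanSpace ℝ (Fin d) → ℝ, ContDiff ℝ ∞ φ → HasCompactSupport φ →
    ∫ x, σ x * ⟪∇ u x, ∇ φ x⟫_ℝ = 0

/-- `∇u` is isotropically realizable in the torus with the positive conductivity `σ`: the function
`σ` is positive, locally integrable and `Y`-periodic, and `div (σ ∇u) = 0` in `ℝ^d`. -/
structure IsRealizableInTorusWith {d : ℕ} (u σ : EuclideanSpace ℝ (Fin d) → ℝ) : Prop where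
  pos : ∀ x, 0 < σ x
  locallyIntegrable : LocallyIntegrable σ volume
  periodic : IsYPeriodic σ
  div_eq_zero : DivSigmaGradEqZero σ u

/-- The laplacian of `u` vanishes at every critical point of `u`. -/
def LaplacianVanishesAtCriticalPoints {d : ℕ} (u : EuclideanSpace ℝ (Fin d) → ℝ) : Prop :=
  ∀ x, ∇ u x = 0 → Δ u x = 0

/-- The integrals of the laplacian of `u` along the forward gradient flow are uniformly bounded. -/
def LaplacianIntegralsBounded {d : ℕ} (u : EuclideanSpace ℝ (Fin d) → ℝ) : Prop :=
  ∃ C : ℝ, 0 < C ∧ ∀ t : ℝ, 0 ≤ t → ∀ x, |∫ s in (0 : ℝ)..t, Δ u (gradientFlow u s x)| ≤ C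

/-- A continuous `Y`-periodic map is bounded. -/
theorem IsYPeriodic.exists_norm_le {d : ℕ} {β : Type*} [NormedAddCommGroup β]
    {f : EuclideanSpace ℝ (Fin d) → β} (hf : IsYPeriodic f) (hc : Continuous f) :
    ∃ K : ℝ≥0, ∀ x, ‖f x‖ ≤ K := by
  have hK : IsCompact ((WithLp.toLp 2 : (Fin d → ℝ) → EuclideanSpace ℝ (Fin d)) ''
      (Icc (0 : Fin d → ℝ) 1)) :=
    isCompact_Icc.image (PiLp.continuous_toLp 2 _)
  obtain ⟨C, hC⟩ := hK.exists_bound_of_continuousOn hc.continuousOn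
  refine ⟨C.toNNReal, fun x => ?_⟩
  have h1 := hf (fun i => ⌊x i⌋) (WithLp.toLp 2 fun i => Int.fract (x i))
  have h2 : (WithLp.toLp 2 fun i => Int.fract (x i)) + (WithLp.toLp 2 fun i => (⌊x i⌋ : ℝ)) = x := by
    ext i
    simp
  rw [h2] at h1
  rw [h1]
  refine (hC _ ⟨_, ⟨fun i => Int.fract_nonneg _, fun i => (Int.fract_lt_one _).le⟩, rfl⟩).trans ?_
  exact Real.le_coe_toNNReal C

theorem contDiff_gradient {d : ℕ} {u : EuclideanSpace ℝ (Fin d) → ℝ} (hu : ContDiff ℝ 2 u) :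
    ContDiff ℝ 1 (∇ u) :=
  (InnerProductSpace.toDual ℝ (EuclideanSpace ℝ (Fin d))).symm.contDiff.comp
    (hu.fderiv_right (m := 1) (by norm_num))

theorem exists_lipschitzWith_gradient {d : ℕ} {u : EuclideanSpace ℝ (Fin d) → ℝ}
    (hu : ContDiff ℝ 2 u) (hper : IsYPeriodic (∇ u)) : ∃ K : ℝ≥0, LipschitzWith K (∇ u) := by
  have h := contDiff_gradient hu
  have hp : IsYPeriodic (fderiv ℝ (∇ u)) := by
    intro k x
    rw [← fderiv_comp_add_right]
    congr 1
    exact funext (hper k)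
  obtain ⟨K, hK⟩ := hp.exists_norm_le (h.continuous_fderiv one_ne_zero)
  exact ⟨K, lipschitzWith_of_nnnorm_fderiv_le (h.differentiable one_ne_zero) fun x => hK x⟩

/-- Global existence for the gradient system. -/
theorem exists_gradientTrajectory {d : ℕ} {u : EuclideanSpace ℝ (Fin d) → ℝ}
    (hu : ContDiff ℝ 2 u) (hper : IsYPeriodic (∇ u)) (x : EuclideanSpace ℝ (Fin d)) :
    ∃ γ : ℝ → EuclideanSpace ℝ (Fin d), γ 0 = x ∧ IsIntegralCurve γ (fun _ => ∇ u) := by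
  have hC := contDiff_gradient hu
  obtain ⟨K, hK⟩ := exists_lipschitzWith_gradient hu hper
  obtain ⟨L, hL⟩ := hper.exists_norm_le hC.continuous
  obtain ⟨w, hw⟩ : ∃ w : EuclideanSpace ℝ (Fin d) → EuclideanSpace ℝ (Fin d), w = ∇ u := ⟨_, rfl⟩
  rw [← hw] at hC hK hL ⊢
  have hv : ContMDiff 𝓘(ℝ, EuclideanSpace ℝ (Fin d)) 𝓘(ℝ, EuclideanSpace ℝ (Fin d)).tangent 1
      (fun y => (⟨y, w y⟩ : TangentBundle 𝓘(ℝ, EuclideanSpace ℝ (Fin d)) _)) :=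
    contMDiff_vectorSpace_iff_contDiff.2 hC
  obtain ⟨γ, h0, hγ⟩ := exists_isMIntegralCurve_of_isMIntegralCurveOn
    (I := 𝓘(ℝ, EuclideanSpace ℝ (Fin d))) (v := w) hv one_pos (fun y => by
      have hpl : IsPicardLindelof (fun _ : ℝ => w) (tmin := -1) (tmax := 1) ⟨0, by simp⟩ y
          L 0 L K :=
        { lipschitzOnWith := fun _ _ => hK.lipschitzOnWith
          continuousOn := fun _ _ => continuousOn_const
          norm_le := fun _ _ z _ => hL z
          mul_max_le := by simp }
      obtain ⟨α, h0, hα⟩ := hpl.exists_eq_forall_mem_Icc_hasDerivWithinAt₀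
      refine ⟨α, h0, fun t ht => ?_⟩
      exact ((hα t ⟨ht.1.le, ht.2.le⟩).hasDerivAt
        (Icc_mem_nhds ht.1 ht.2)).hasFDerivAt.hasMFDerivAt.hasMFDerivWithinAt) x
  refine ⟨γ, h0, fun t => ?_⟩
  have h : HasFDerivAt γ (ContinuousLinearMap.toSpanSingleton ℝ (w (γ t))) t :=
    hasMFDerivAt_iff_hasFDerivAt.1 (hγ t)
  simpa using h.hasDerivAt

/-- The gradient flow solves the gradient system. -/
theorem gradientFlow_spec {d : ℕ} {u : EuclideanSpace ℝ (Fin d) → ℝ}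
    (hu : ContDiff ℝ 2 u) (hper : IsYPeriodic (∇ u)) (x : EuclideanSpace ℝ (Fin d)) :
    gradientFlow u 0 x = x ∧
      ∀ t, HasDerivAt (fun s => gradientFlow u s x) (∇ u (gradientFlow u t x)) t := by
  have h := exists_gradientTrajectory hu hper x
  have h1 : (fun s => gradientFlow u s x) = h.choose := by
    funext s
    simp only [gradientFlow, dif_pos h]
  have h2 : ∀ s, gradientFlow u s x = h.choose s := congrFun h1
  rw [h1]
  refine ⟨(h2 0).trans h.choose_spec.1, fun t => ?_⟩
  rw [h2]
  exact h.choose_spec.2 t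

/-- Uniqueness for the gradient system. -/
theorem eq_gradientFlow {d : ℕ} {u : EuclideanSpace ℝ (Fin d) → ℝ}
    (hu : ContDiff ℝ 2 u) (hper : IsYPeriodic (∇ u)) {x : EuclideanSpace ℝ (Fin d)}
    {γ : ℝ → EuclideanSpace ℝ (Fin d)} (h0 : γ 0 = x) (hγ : ∀ t, HasDerivAt γ (∇ u (γ t)) t) :
    γ = fun t => gradientFlow u t x := by
  obtain ⟨K, hK⟩ := exists_lipschitzWith_gradient hu hper
  obtain ⟨g0, hg⟩ := gradientFlow_spec hu hper x
  exact ODE_solution_unique_univ (v := fun _ => ∇ u) (s := fun _ => univ) (t₀ := 0)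
    (fun _ => hK.lipschitzOnWith) (fun t => ⟨hγ t, mem_univ _⟩) (fun t => ⟨hg t, mem_univ _⟩)
    (h0.trans g0.symm)

/-!
Let `v = ∇u`, let `X` be its flow and let `I t x` be the integral of `div v = Δu` over `[0, t]`
along the trajectory of `x`. The Liouville theorem says that Lebesgue measure with density
`exp (I t)` is pushed forward by `X t` to Lebesgue measure. Since `v` is Lipschitz, so is `X t`,
and this can be proved without differentiating the flow in space: by the weak divergence theorem
for Lipschitz functions, the integral of `exp (I t) * g (X t)` has zero derivative in `t`. As
`div v` is merely continuous, it is replaced there by smooth functions at uniform distance at most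
`ε`, and the Grönwall inequality controls the error.

When the `I t` are bounded, `S x = sup_t I t x`, taken over all `t ∈ ℝ`, is bounded and the
cocycle identity `I (s + t) x = I t x + I s (X t x)` gives `S (X t x) = S x - I t x`. Hence
`σ = exp S` is the density of a measure invariant under the flow, and differentiating the integral
of `σ * φ (X t)` at `t = 0` yields `div (σ v) = 0`. Conversely, if `σ` is `C¹` and
`div (σ v) = 0`, then `log σ` has derivative `-div v` along trajectories, so that
`I t x = log σ(x) - log σ(X t x)` is bounded, and `σ div v = 0` wherever `v = 0`.
-/

open Filter
open scoped Topology

/-! ### Flows of Lipschitz vector fields -/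

theorem exists_lipschitzWith_of_hasCompactSupport {α β : Type*} [PseudoMetricSpace α]
    [ProperSpace α] [SeminormedAddCommGroup β] {f : α → β} (hf : LocallyLipschitz f)
    (hc : HasCompactSupport f) : ∃ C, LipschitzWith C f := by
  have hK : IsCompact (Metric.cthickening 1 (tsupport f)) := hc.isCompact.cthickening
  obtain ⟨L, hL⟩ := (hf.locallyLipschitzOn (s := Metric.cthickening 1 (tsupport f))
    ).exists_lipschitzOnWith_of_compact hK
  obtain ⟨M, hM⟩ := hc.exists_bound_of_continuous hf.continuous
  have hM0 (x : α) : 0 ≤ M := (norm_nonneg _).trans (hM x)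
  have hsupp : ∀ x ∈ tsupport f, ∀ y, dist (f x) (f y) ≤ (L + M.toNNReal : ℝ≥0) * dist x y := by
    intro x hx y
    rw [NNReal.coe_add, Real.coe_toNNReal _ (hM0 x), add_mul]
    by_cases hy : y ∈ Metric.cthickening 1 (tsupport f)
    · have := hL.dist_le_mul x (Metric.self_subset_cthickening _ hx) y hy
      linarith [mul_nonneg (hM0 x) (dist_nonneg (x := x) (y := y))]
    · have hfy : f y = 0 := image_eq_zero_of_notMem_tsupport fun h =>
        hy (Metric.self_subset_cthickening _ h)
      have hxy : 1 ≤ dist x y := by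
        by_contra! h
        exact hy (Metric.mem_cthickening_of_dist_le y x 1 _ hx (dist_comm x y ▸ h.le))
      rw [hfy, dist_zero_right]
      nlinarith [hM x, hM0 x, mul_nonneg L.2 (dist_nonneg (x := x) (y := y)), norm_nonneg (f x)]
  refine ⟨L + M.toNNReal, LipschitzWith.of_dist_le_mul fun x y => ?_⟩
  by_cases hx : x ∈ tsupport f
  · exact hsupp x hx y
  by_cases hy : y ∈ tsupport f
  · rw [dist_comm, dist_comm x]
    exact hsupp y hy x
  · rw [image_eq_zero_of_notMem_tsupport hx, image_eq_zero_of_notMem_tsupport hy, dist_self]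
    positivity

theorem dist_le_of_isIntegralCurve {E : Type*} [NormedAddCommGroup E] [NormedSpace ℝ E]
    {v : E → E} {K : ℝ≥0} (hv : LipschitzWith K v) {f g : ℝ → E}
    (hf : IsIntegralCurve f fun _ => v) (hg : IsIntegralCurve g fun _ => v) (t : ℝ) :
    dist (f t) (g t) ≤ dist (f 0) (g 0) * Real.exp (K * |t|) := by
  have forward {v : E → E} {f g : ℝ → E} (hv : LipschitzWith K v)
      (hf : IsIntegralCurve f fun _ => v) (hg : IsIntegralCurve g fun _ => v) {t : ℝ}
      (ht : 0 ≤ t) : dist (f t) (g t) ≤ dist (f 0) (g 0) * Real.exp (K * t) := by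
    simpa using dist_le_of_trajectories_ODE (v := fun _ => v) (b := t) (fun _ => hv)
      hf.continuous.continuousOn (fun s _ => (hf s).hasDerivWithinAt)
      hg.continuous.continuousOn (fun s _ => (hg s).hasDerivWithinAt) le_rfl t ⟨ht, le_rfl⟩
  have reverse {f : ℝ → E} (hf : IsIntegralCurve f fun _ => v) :
      IsIntegralCurve (fun t => f (-t)) fun _ x => -v x := fun t => by
    simpa [Function.comp_def] using (hf (-t)).scomp t (hasDerivAt_neg t)
  rcases le_total 0 t with ht | ht
  · rw [abs_of_nonneg ht]
    exact forward hv hf hg ht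
  · rw [abs_of_nonpos ht]
    simpa using forward (v := fun x => -v x) hv.neg (reverse hf) (reverse hg) (neg_nonneg.2 ht)

/-- `X t x` is the position at time `t` of a trajectory of the autonomous vector field `v` that
starts at `x`, all trajectories being defined for all times. No regularity of `X` in `x` is
required: when `v` is Lipschitz, so is `X t`. -/
structure IsFlowOf {E : Type*} [NormedAddCommGroup E] [NormedSpace ℝ E] (X : ℝ → E → E)
    (v : E → E) : Prop where
  map_zero : ∀ x, X 0 x = x
  isIntegralCurve : ∀ x, IsIntegralCurve (X · x) fun _ => v

/-- The integral of the scalar function `ρ` over the time interval `[0, t]` along the trajectory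
`X · x`. -/
noncomputable def flowIntegral {E : Type*} (X : ℝ → E → E) (ρ : E → ℝ) (t : ℝ) (x : E) : ℝ :=
  ∫ s in 0..t, ρ (X s x)

/-- The function `g` transported by `X` with growth rate `ρ`: the solution at time `t` of
`∂ₜ w = Dw · v + ρ w`, `w = g` at time `0`, when `X` is the flow of `v`. -/
noncomputable def weightedPullback {E : Type*} (X : ℝ → E → E) (ρ g : E → ℝ) (t : ℝ) (x : E) : ℝ :=
  Real.exp (flowIntegral X ρ t x) * g (X t x)

namespace IsFlowOf

variable {E : Type*} [NormedAddCommGroup E] [NormedSpace ℝ E] {X : ℝ → E → E} {v : E → E}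
  {K : ℝ≥0}

theorem map_add (hX : IsFlowOf X v) (hv : LipschitzWith K v) (s t : ℝ) (x : E) :
    X (s + t) x = X s (X t x) := by
  refine congrFun (ODE_solution_unique_univ (v := fun _ => v) (s := fun _ => univ) (t₀ := 0)
    (f := fun s => X (s + t) x) (g := (X · (X t x))) (fun _ => hv.lipschitzOnWith)
    (fun r => ⟨(hX.isIntegralCurve x (r + t)).comp_add_const r t, mem_univ _⟩)
    (fun r => ⟨hX.isIntegralCurve _ r, mem_univ _⟩) ?_) s
  simp [hX.map_zero]

theorem map_neg_map (hX : IsFlowOf X v) (hv : LipschitzWith K v) (t : ℝ) (x : E) :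
    X (-t) (X t x) = x := by
  rw [← hX.map_add hv, neg_add_cancel, hX.map_zero]

theorem map_add_period (hX : IsFlowOf X v) (hv : LipschitzWith K v) {c : E}
    (hc : Function.Periodic v c) (t : ℝ) (x : E) : X t (x + c) = X t x + c := by
  refine congrFun (ODE_solution_unique_univ (v := fun _ => v) (s := fun _ => univ) (t₀ := 0)
    (f := (X · (x + c))) (g := fun s => X s x + c) (fun _ => hv.lipschitzOnWith)
    (fun r => ⟨hX.isIntegralCurve _ r, mem_univ _⟩) (fun r => ⟨?_, mem_univ _⟩) ?_) t
  · simpa only [hc (X r x)] using (hX.isIntegralCurve x r).add_const c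
  · simp only [hX.map_zero]

theorem dist_le (hX : IsFlowOf X v) (hv : LipschitzWith K v) (t : ℝ) (x y : E) :
    dist (X t x) (X t y) ≤ dist x y * Real.exp (K * |t|) := by
  simpa only [hX.map_zero] using
    dist_le_of_isIntegralCurve hv (hX.isIntegralCurve x) (hX.isIntegralCurve y) t

theorem lipschitzWith (hX : IsFlowOf X v) (hv : LipschitzWith K v) (t : ℝ) :
    LipschitzWith (Real.exp (K * |t|)).toNNReal (X t) :=
  LipschitzWith.of_dist_le_mul fun x y => by
    rw [Real.coe_toNNReal _ (Real.exp_pos _).le, mul_comm]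
    exact hX.dist_le hv t x y

theorem continuous_uncurry (hX : IsFlowOf X v) (hv : LipschitzWith K v) :
    Continuous (Function.uncurry X) := by
  refine continuous_iff_continuousAt.2 fun ⟨t, x⟩ => ?_
  have hbound : Tendsto (fun p : ℝ × E =>
      dist p.2 x * Real.exp (K * |p.1|) + dist (X p.1 x) (X t x)) (𝓝 (t, x)) (𝓝 0) := by
    have hXx : Continuous fun p : ℝ × E => X p.1 x :=
      (hX.isIntegralCurve x).continuous.comp continuous_fst
    have hexp : Continuous fun p : ℝ × E => dist p.2 x * Real.exp (K * |p.1|) := by fun_prop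
    exact (hexp.add (hXx.dist continuous_const)).tendsto' _ _ (by simp)
  refine tendsto_iff_dist_tendsto_zero.2 (squeeze_zero (fun _ => dist_nonneg) (fun p => ?_) hbound)
  exact (dist_triangle _ (X p.1 x) _).trans (add_le_add_left (hX.dist_le hv p.1 p.2 x) _)

theorem continuous_flowIntegral (hX : IsFlowOf X v) (hv : LipschitzWith K v) {ρ : E → ℝ}
    (hρ : Continuous ρ) : Continuous (Function.uncurry (flowIntegral X ρ)) := by
  have hXc := hX.continuous_uncurry hv
  have : Continuous (Function.uncurry fun (p : ℝ × E) s => ρ (X s p.2)) :=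
    hρ.comp (hXc.comp (by fun_prop : Continuous fun q : (ℝ × E) × ℝ => (q.2, q.1.2)))
  exact intervalIntegral.continuous_parametric_intervalIntegral_of_continuous this continuous_fst

theorem hasDerivAt_flowIntegral (hX : IsFlowOf X v) {ρ : E → ℝ} (hρ : Continuous ρ) (t : ℝ)
    (x : E) : HasDerivAt (flowIntegral X ρ · x) (ρ (X t x)) t :=
  (hρ.comp (hX.isIntegralCurve x).continuous).integral_hasStrictDerivAt 0 t |>.hasDerivAt

theorem flowIntegral_add (hX : IsFlowOf X v) (hv : LipschitzWith K v) {ρ : E → ℝ}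
    (hρ : Continuous ρ) (s t : ℝ) (x : E) :
    flowIntegral X ρ (s + t) x = flowIntegral X ρ t x + flowIntegral X ρ s (X t x) := by
  have hint (a b : ℝ) : IntervalIntegrable (fun r => ρ (X r x)) volume a b :=
    (hρ.comp (hX.isIntegralCurve x).continuous).intervalIntegrable a b
  have hshift : flowIntegral X ρ s (X t x) = ∫ r in t..s + t, ρ (X r x) := by
    simp only [flowIntegral, ← hX.map_add hv,
      intervalIntegral.integral_comp_add_right (fun r => ρ (X r x)), zero_add]
  rw [hshift]
  exact (intervalIntegral.integral_add_adjacent_intervals (hint _ _) (hint _ _)).symm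

theorem flowIntegral_add_period (hX : IsFlowOf X v) (hv : LipschitzWith K v) {ρ : E → ℝ} {c : E}
    (hvc : Function.Periodic v c) (hρc : Function.Periodic ρ c) (t : ℝ) :
    Function.Periodic (flowIntegral X ρ t) c := fun x => by
  simp only [flowIntegral, hX.map_add_period hv hvc, hρc _]

theorem locallyLipschitz_flowIntegral [ProperSpace E] (hX : IsFlowOf X v)
    (hv : LipschitzWith K v) {ρ : E → ℝ} (hρ : LocallyLipschitz ρ) (t : ℝ) :
    LocallyLipschitz (flowIntegral X ρ t) := by
  intro x₀
  obtain ⟨L, hL⟩ := (hρ.locallyLipschitzOn (s := Function.uncurry X '' (uIcc 0 t ×ˢ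
    Metric.closedBall x₀ 1))).exists_lipschitzOnWith_of_compact
      ((isCompact_uIcc.prod (isCompact_closedBall x₀ 1)).image (hX.continuous_uncurry hv))
  refine ⟨L * (Real.exp (K * |t|)).toNNReal * |t|.toNNReal, Metric.closedBall x₀ 1,
    Metric.closedBall_mem_nhds x₀ one_pos, LipschitzOnWith.of_dist_le_mul fun x hx y hy => ?_⟩
  have hint (z : E) : IntervalIntegrable (fun s => ρ (X s z)) volume 0 t :=
    (hρ.continuous.comp (hX.isIntegralCurve z).continuous).intervalIntegrable 0 t
  have hbound : ∀ s ∈ uIoc 0 t, ‖ρ (X s x) - ρ (X s y)‖ ≤ L * (dist x y * Real.exp (K * |t|)) := by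
    intro s hs
    have hs' := uIoc_subset_uIcc hs
    have hst : |s| ≤ |t| := by simpa using abs_sub_left_of_mem_uIcc hs'
    rw [← dist_eq_norm]
    refine (hL.dist_le_mul _ ⟨(s, x), ⟨hs', hx⟩, rfl⟩ _ ⟨(s, y), ⟨hs', hy⟩, rfl⟩).trans ?_
    gcongr
    exact (hX.dist_le hv s x y).trans (by gcongr)
  rw [dist_eq_norm, flowIntegral, flowIntegral, ← intervalIntegral.integral_sub (hint x) (hint y)]
  refine (intervalIntegral.norm_integral_le_of_norm_le_const hbound).trans_eq ?_
  push_cast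
  rw [Real.coe_toNNReal _ (Real.exp_pos _).le, Real.coe_toNNReal _ (abs_nonneg t), sub_zero]
  ring

theorem continuous_weightedPullback (hX : IsFlowOf X v) (hv : LipschitzWith K v) {ρ g : E → ℝ}
    (hρ : Continuous ρ) (hg : Continuous g) :
    Continuous (Function.uncurry (weightedPullback X ρ g)) :=
  (hX.continuous_flowIntegral hv hρ).rexp.mul (hg.comp (hX.continuous_uncurry hv))

theorem weightedPullback_add (hX : IsFlowOf X v) (hv : LipschitzWith K v) {ρ : E → ℝ}
    (hρ : Continuous ρ) (g : E → ℝ) (s t : ℝ) :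
    weightedPullback X ρ g (s + t) = weightedPullback X ρ (weightedPullback X ρ g s) t := by
  ext x
  simp only [weightedPullback, hX.flowIntegral_add hv hρ, hX.map_add hv, Real.exp_add, mul_assoc]

theorem exists_isCompact_weightedPullback_eq_zero (hX : IsFlowOf X v) (hv : LipschitzWith K v)
    (ρ : E → ℝ) {g : E → ℝ} (hg : HasCompactSupport g) {s : Set ℝ} (hs : IsCompact s) :
    ∃ k, IsCompact k ∧ ∀ t ∈ s, ∀ x ∉ k, weightedPullback X ρ g t x = 0 := by
  refine ⟨(fun p : ℝ × E => X (-p.1) p.2) '' (s ×ˢ tsupport g), (hs.prod hg).image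
    ((hX.continuous_uncurry hv).comp (by fun_prop : Continuous fun p : ℝ × E => (-p.1, p.2))),
    fun t ht x hx => ?_⟩
  refine mul_eq_zero_of_right _ (image_eq_zero_of_notMem_tsupport fun hgx => hx ?_)
  exact ⟨(t, X t x), ⟨ht, hgx⟩, hX.map_neg_map hv t x⟩

theorem hasCompactSupport_weightedPullback (hX : IsFlowOf X v) (hv : LipschitzWith K v)
    (ρ : E → ℝ) {g : E → ℝ} (hg : HasCompactSupport g) (t : ℝ) :
    HasCompactSupport (weightedPullback X ρ g t) := by
  obtain ⟨k, hk, h⟩ := hX.exists_isCompact_weightedPullback_eq_zero hv ρ hg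
    (isCompact_singleton (x := t))
  exact .intro hk fun x hx => h t rfl x hx

theorem exists_lipschitzWith_weightedPullback [ProperSpace E] (hX : IsFlowOf X v)
    (hv : LipschitzWith K v) {ρ g : E → ℝ} (hρ : LocallyLipschitz ρ) (hg : LocallyLipschitz g)
    (hgc : HasCompactSupport g) (t : ℝ) : ∃ C, LipschitzWith C (weightedPullback X ρ g t) := by
  have hmul : LocallyLipschitz fun p : ℝ × ℝ => Real.exp p.1 * p.2 :=
    ContDiff.locallyLipschitz (𝕂 := ℝ) (by fun_prop)
  exact exists_lipschitzWith_of_hasCompactSupport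
    (hmul.comp ((hX.locallyLipschitz_flowIntegral hv hρ t).prodMk
      (hg.comp (hX.lipschitzWith hv t).locallyLipschitz)))
    (hX.hasCompactSupport_weightedPullback hv ρ hgc t)

theorem hasDerivAt_weightedPullback (hX : IsFlowOf X v) {ρ g : E → ℝ} (hρ : Continuous ρ) {t : ℝ}
    {x : E} (hg : DifferentiableAt ℝ g (X t x)) :
    HasDerivAt (weightedPullback X ρ g · x)
      (weightedPullback X ρ (fun y => fderiv ℝ g y (v y) + ρ y * g y) t x) t := by
  refine ((hX.hasDerivAt_flowIntegral hρ t x).exp.mul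
    (hg.hasFDerivAt.comp_hasDerivAt t (hX.isIntegralCurve x t))).congr_deriv ?_
  simp only [weightedPullback, Function.comp_apply]
  ring

end IsFlowOf

/-! ### Divergence and integration -/

/-- The divergence of a vector field on a finite-dimensional space, as the trace of the derivative;
by the conventions for `fderiv` and `trace` it is `0` where the field is not differentiable. -/
noncomputable def divergence {E : Type*} [NormedAddCommGroup E] [NormedSpace ℝ E] (v : E → E)
    (x : E) : ℝ :=
  LinearMap.trace ℝ E (fderiv ℝ v x)

theorem divergence_eq_sum {E ι : Type*} [NormedAddCommGroup E] [NormedSpace ℝ E]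
    [Fintype ι] (b : Module.Basis ι ℝ E) (v : E → E) (x : E) :
    divergence v x = ∑ i, b.repr (fderiv ℝ v x (b i)) i := by
  classical
  simp [divergence, LinearMap.trace_eq_matrix_trace ℝ b, Matrix.trace, LinearMap.toMatrix_apply]

theorem continuous_divergence {E : Type*} [NormedAddCommGroup E] [NormedSpace ℝ E]
    [FiniteDimensional ℝ E] {v : E → E} (hv : ContDiff ℝ 1 v) : Continuous (divergence v) := by
  have htrace : Continuous fun A : E →L[ℝ] E => LinearMap.trace ℝ E A :=
    ((LinearMap.trace ℝ E).comp (ContinuousLinearMap.coeLM ℝ)).continuous_of_finiteDimensional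
  exact htrace.comp (hv.continuous_fderiv one_ne_zero)

theorem divergence_gradient {F : Type*} [NormedAddCommGroup F] [InnerProductSpace ℝ F]
    [FiniteDimensional ℝ F] {u : F → ℝ} (hu : ContDiff ℝ 2 u) : divergence (∇ u) = Δ u := by
  ext x
  have hfderiv : HasFDerivAt (∇ u)
      ((InnerProductSpace.toDual ℝ F).symm.toContinuousLinearEquiv.toContinuousLinearMap.comp
        (fderiv ℝ (fderiv ℝ u) x)) x :=
    (InnerProductSpace.toDual ℝ F).symm.toContinuousLinearEquiv.hasFDerivAt.comp x
      ((hu.fderiv_right (m := 1) (by norm_num)).differentiable one_ne_zero x).hasFDerivAt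
  rw [InnerProductSpace.laplacian_eq_iteratedFDeriv_stdOrthonormalBasis, divergence,
    LinearMap.trace_eq_sum_inner _ (stdOrthonormalBasis ℝ F), hfderiv.fderiv]
  refine Finset.sum_congr rfl fun i _ => ?_
  rw [iteratedFDeriv_two_apply, real_inner_comm]
  exact InnerProductSpace.toDual_symm_apply

theorem integrable_mul_fderiv_of_hasCompactSupport {E : Type*} [NormedAddCommGroup E]
    [NormedSpace ℝ E] [ProperSpace E] [MeasurableSpace E] [BorelSpace E] {μ : Measure E}
    [IsFiniteMeasureOnCompacts μ] {f g : E → ℝ} {C : ℝ≥0} (hf : Continuous f)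
    (hg : LipschitzWith C g) (hgc : HasCompactSupport g) (w : E) :
    Integrable (fun x => f x * fderiv ℝ g x w) μ := by
  have hbound : MemLp (fun x => fderiv ℝ g x w) ⊤ μ :=
    memLp_top_of_bound (measurable_fderiv_apply_const ℝ g w).aestronglyMeasurable (C * ‖w‖)
      (.of_forall fun x => ((fderiv ℝ g x).le_opNorm w).trans
        (by gcongr; exact norm_fderiv_le_of_lipschitz ℝ hg))
  refine (integrableOn_iff_integrable_of_support_subset fun x hx => ?_).1
    (((hbound.locallyIntegrable le_top).integrableOn_isCompact hgc).continuousOn_mul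
      hf.continuousOn hgc)
  refine support_fderiv_subset ℝ fun h => hx ?_
  simp [h]

theorem integral_mul_fderiv_eq_neg_fderiv_mul_of_lipschitzWith {E : Type*} [NormedAddCommGroup E]
    [NormedSpace ℝ E] [FiniteDimensional ℝ E] [MeasurableSpace E] [BorelSpace E] (μ : Measure E)
    [μ.IsAddHaarMeasure] {f g : E → ℝ} {C D : ℝ≥0} (hf : LipschitzWith C f)
    (hg : LipschitzWith D g) (hgc : HasCompactSupport g) (w : E) :
    ∫ x, f x * fderiv ℝ g x w ∂μ = -∫ x, fderiv ℝ f x w * g x ∂μ := by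
  have hfderiv {h : E → ℝ} {L : ℝ≥0} (hh : LipschitzWith L h) :
      (fun x => fderiv ℝ h x w) =ᵐ[μ] fun x => lineDeriv ℝ h x w := by
    filter_upwards [hh.ae_differentiableAt] with x hx using hx.lineDeriv_eq_fderiv.symm
  calc ∫ x, f x * fderiv ℝ g x w ∂μ = -∫ x, lineDeriv ℝ g x (-w) * f x ∂μ := by
        rw [← integral_neg]
        refine integral_congr_ae ((hfderiv hg).mono fun x hx => ?_)
        simp only [hx, lineDeriv_neg]
        ring
    _ = -∫ x, lineDeriv ℝ f x w * g x ∂μ := by rw [← hf.integral_lineDeriv_mul_eq hg hgc]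
    _ = -∫ x, fderiv ℝ f x w * g x ∂μ := by
        rw [integral_congr_ae ((hfderiv hf).fun_mul (ae_eq_refl g))]

theorem integral_fderiv_apply_eq_neg_integral_mul_divergence {E : Type*} [NormedAddCommGroup E]
    [NormedSpace ℝ E] [FiniteDimensional ℝ E] [MeasurableSpace E] [BorelSpace E] (μ : Measure E)
    [μ.IsAddHaarMeasure] {v : E → E} {K C : ℝ≥0} (hv : LipschitzWith K v) {g : E → ℝ}
    (hg : LipschitzWith C g) (hgc : HasCompactSupport g) :
    ∫ x, fderiv ℝ g x (v x) ∂μ = -∫ x, divergence v x * g x ∂μ := by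
  have : ProperSpace E := FiniteDimensional.proper ℝ E
  let b := Module.finBasis ℝ E
  let coord (i) : E →L[ℝ] ℝ := LinearMap.toContinuousLinearMap (b.coord i)
  have hcoord (i) : LipschitzWith (‖coord i‖₊ * K) (coord i ∘ v) := (coord i).lipschitz.comp hv
  have hint (i) : Integrable (fun x => fderiv ℝ (coord i ∘ v) x (b i) * g x) μ :=
    (((hcoord i).memLp_lineDeriv (b i)).locallyIntegrable le_top
      ).integrable_smul_right_of_hasCompactSupport hg.continuous hgc |>.congr <| by
        filter_upwards [(hcoord i).ae_differentiableAt] with x hx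
        rw [hx.lineDeriv_eq_fderiv, smul_eq_mul]
  have hdiv : ∀ᵐ x ∂μ, divergence v x * g x = ∑ i, fderiv ℝ (coord i ∘ v) x (b i) * g x := by
    filter_upwards [hv.ae_differentiableAt] with x hx
    rw [divergence_eq_sum b, Finset.sum_mul]
    refine Finset.sum_congr rfl fun i _ => ?_
    rw [((coord i).hasFDerivAt.comp x hx.hasFDerivAt).fderiv]
    rfl
  calc ∫ x, fderiv ℝ g x (v x) ∂μ = ∫ x, ∑ i, coord i (v x) * fderiv ℝ g x (b i) ∂μ := by
        congr 1 with x
        conv_lhs => rw [← b.sum_repr (v x), map_sum]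
        simp only [map_smul, smul_eq_mul]
        rfl
    _ = ∑ i, ∫ x, coord i (v x) * fderiv ℝ g x (b i) ∂μ :=
        integral_finsetSum _ fun i _ =>
          integrable_mul_fderiv_of_hasCompactSupport (hcoord i).continuous hg hgc (b i)
    _ = -∑ i, ∫ x, fderiv ℝ (coord i ∘ v) x (b i) * g x ∂μ := by
        rw [← Finset.sum_neg_distrib]
        exact Finset.sum_congr rfl fun i _ =>
          integral_mul_fderiv_eq_neg_fderiv_mul_of_lipschitzWith μ (hcoord i) hg hgc (b i)
    _ = -∫ x, divergence v x * g x ∂μ := by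
        rw [integral_congr_ae hdiv, integral_finsetSum _ fun i _ => hint i]

theorem hasDerivAt_integral_of_continuous_of_isCompact {α : Type*} [TopologicalSpace α]
    [T2Space α] [MeasurableSpace α] [OpensMeasurableSpace α] {μ : Measure α}
    [IsFiniteMeasureOnCompacts μ] {F F' : ℝ → α → ℝ} (hF : Continuous (Function.uncurry F))
    (hF' : Continuous (Function.uncurry F')) (hderiv : ∀ t x, HasDerivAt (F · x) (F' t x) t)
    {t₀ ε : ℝ} (hε : 0 < ε) {k : Set α} (hk : IsCompact k)
    (hFk : ∀ t ∈ Metric.closedBall t₀ ε, ∀ x ∉ k, F t x = 0) :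
    HasDerivAt (fun t => ∫ x, F t x ∂μ) (∫ x, F' t₀ x ∂μ) t₀ := by
  obtain ⟨M, hM⟩ := ((isCompact_closedBall t₀ ε).prod hk).exists_bound_of_continuousOn
    hF'.continuousOn
  have hF'k : ∀ t ∈ Metric.ball t₀ ε, ∀ x ∉ k, F' t x = 0 := fun t ht x hx =>
    (hderiv t x).unique <| (hasDerivAt_const t (0 : ℝ)).congr_of_eventuallyEq <| by
      filter_upwards [Metric.isOpen_ball.mem_nhds ht] with s hs
      exact hFk s (Metric.ball_subset_closedBall hs) x hx
  have hslice {G : ℝ → α → ℝ} (hG : Continuous (Function.uncurry G)) (t : ℝ) : Continuous (G t) :=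
    hG.comp (Continuous.prodMk_right t)
  refine (hasDerivAt_integral_of_dominated_loc_of_deriv_le (bound := k.indicator fun _ => M)
    (Metric.ball_mem_nhds t₀ hε) (.of_forall fun t => (hslice hF t).aestronglyMeasurable)
    ((hslice hF t₀).integrable_of_hasCompactSupport
      (.intro hk fun x hx => hFk t₀ (Metric.mem_closedBall_self hε.le) x hx))
    (hslice hF' t₀).aestronglyMeasurable (.of_forall fun x t ht => ?_)
    ((integrable_indicator_iff hk.measurableSet).2 (integrableOn_const hk.measure_lt_top.ne))
    (.of_forall fun x t _ => hderiv t x)).2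
  by_cases hx : x ∈ k
  · rw [indicator_of_mem hx]
    exact hM (t, x) ⟨Metric.ball_subset_closedBall ht, hx⟩
  · rw [indicator_of_notMem hx, hF'k t ht x hx, norm_zero]

theorem tendsto_integral_pow_measureReal {α : Type*} [TopologicalSpace α] [MeasurableSpace α]
    [OpensMeasurableSpace α] (μ : Measure α) [IsFiniteMeasureOnCompacts μ]
    {g : α → ℝ} (hg : Continuous g) (hgc : HasCompactSupport g) (h0 : 0 ≤ g) (h1 : g ≤ 1) :
    Tendsto (fun n : ℕ => ∫ x, g x ^ (n + 1) ∂μ) atTop (𝓝 (μ.real {x | g x = 1})) := by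
  have hk : MeasurableSet {x | g x = 1} := (isClosed_eq hg continuous_const).measurableSet
  rw [← integral_indicator_one hk]
  refine tendsto_integral_of_dominated_convergence g
    (fun n => (hg.pow (n + 1)).aestronglyMeasurable) (hg.integrable_of_hasCompactSupport hgc)
    (fun n => .of_forall fun x => ?_) (.of_forall fun x => ?_)
  · rw [Real.norm_of_nonneg (pow_nonneg (h0 x) _)]
    exact pow_le_of_le_one (h0 x) (h1 x) n.succ_ne_zero
  · by_cases hx : g x = 1
    · simp [indicator, hx]
    · rw [indicator_of_notMem (s := {x | g x = 1}) hx]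
      exact (tendsto_pow_atTop_nhds_zero_of_lt_one (h0 x) ((h1 x).lt_of_ne hx)).comp
        (tendsto_add_atTop_nat 1)

theorem exists_contDiff_hasCompactSupport_eq_one_iff {E : Type*} [NormedAddCommGroup E]
    [NormedSpace ℝ E] [FiniteDimensional ℝ E] {k : Set E} (hk : IsCompact k) :
    ∃ g : E → ℝ, ContDiff ℝ ∞ g ∧ HasCompactSupport g ∧ 0 ≤ g ∧ g ≤ 1 ∧ {x | g x = 1} = k := by
  have : ProperSpace E := FiniteDimensional.proper ℝ E
  obtain ⟨g, hg, hrange, hzero, hone⟩ := exists_contMDiff_zero_iff_one_iff_of_isClosed 𝓘(ℝ, E)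
    (n := ⊤) (s := (Metric.thickening 1 k)ᶜ) (t := k) Metric.isOpen_thickening.isClosed_compl
    hk.isClosed (disjoint_compl_left_iff_subset.2 (Metric.self_subset_thickening one_pos k))
  refine ⟨g, hg.contDiff, .intro (hk.cthickening (r := 1)) fun x hx => (hzero x).1 fun h =>
    hx (Metric.thickening_subset_cthickening 1 k h), fun x => (hrange ⟨x, rfl⟩).1,
    fun x => (hrange ⟨x, rfl⟩).2, ?_⟩
  ext x
  exact (hone x).symm

theorem measure_eq_of_forall_integral_contDiff_eq {E : Type*} [NormedAddCommGroup E]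
    [NormedSpace ℝ E] [FiniteDimensional ℝ E] [MeasurableSpace E] [BorelSpace E] {μ ν : Measure E}
    [IsFiniteMeasureOnCompacts μ] [IsFiniteMeasureOnCompacts ν]
    (h : ∀ g : E → ℝ, ContDiff ℝ ∞ g → HasCompactSupport g → 0 ≤ g → ∫ x, g x ∂μ = ∫ x, g x ∂ν) :
    μ = ν := by
  have : ProperSpace E := FiniteDimensional.proper ℝ E
  refine Measure.OuterRegular.ext_isOpen fun U hU =>
    Measure.InnerRegularWRT.eq_of_innerRegularWRT_of_forall_eq Measure.Regular.innerRegular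
      Measure.Regular.innerRegular (fun k hk => ?_) hU
  obtain ⟨g, hg, hgc, h0, h1, rfl⟩ := exists_contDiff_hasCompactSupport_eq_one_iff hk
  rw [← measureReal_eq_measureReal_iff hk.measure_lt_top.ne hk.measure_lt_top.ne]
  refine tendsto_nhds_unique (tendsto_integral_pow_measureReal μ hg.continuous hgc h0 h1)
    ((tendsto_integral_pow_measureReal ν hg.continuous hgc h0 h1).congr fun n => ?_)
  exact (h _ (hg.pow (n + 1)) (hgc.mono fun x hx hgx => hx (by simp [hgx]))
    fun x => pow_nonneg (h0 x) _).symm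

/-! ### The Liouville theorem -/

theorem le_exp_mul_of_abs_deriv_le {F F' : ℝ → ℝ} {ε : ℝ} (hF : ∀ t, HasDerivAt F (F' t) t)
    (hF' : ∀ t, |F' t| ≤ ε * F t) (s t : ℝ) : F t ≤ Real.exp (ε * |t - s|) * F s := by
  have hderiv (c t : ℝ) : HasDerivAt (fun t => Real.exp (c * t) * F t)
      (Real.exp (c * t) * (c * F t + F' t)) t := by
    refine ((((hasDerivAt_id t).const_mul c).exp).mul (hF t)).congr_deriv ?_
    simp only [id_eq]
    ring
  have hmono : Monotone fun t => Real.exp (ε * t) * F t :=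
    monotone_of_hasDerivAt_nonneg (hderiv ε) fun t =>
      mul_nonneg (Real.exp_pos _).le (by linarith [(abs_le.1 (hF' t)).1])
  have hanti : Antitone fun t => Real.exp (-ε * t) * F t :=
    antitone_of_hasDerivAt_nonpos (hderiv (-ε)) fun t =>
      mul_nonpos_of_nonneg_of_nonpos (Real.exp_pos _).le (by linarith [(abs_le.1 (hF' t)).2])
  have hcancel (c : ℝ) : F t = Real.exp (-(c * t)) * (Real.exp (c * t) * F t) := by
    rw [← mul_assoc, ← Real.exp_add, neg_add_cancel, Real.exp_zero, one_mul]
  rcases le_total s t with h | h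
  · calc F t ≤ Real.exp (-(-ε * t)) * (Real.exp (-ε * s) * F s) := by
          rw [hcancel (-ε)]
          exact mul_le_mul_of_nonneg_left (hanti h) (Real.exp_pos _).le
      _ = Real.exp (ε * |t - s|) * F s := by
          rw [← mul_assoc, ← Real.exp_add, abs_of_nonneg (sub_nonneg.2 h)]
          ring_nf
  · calc F t ≤ Real.exp (-(ε * t)) * (Real.exp (ε * s) * F s) := by
          rw [hcancel ε]
          exact mul_le_mul_of_nonneg_left (hmono h) (Real.exp_pos _).le
      _ = Real.exp (ε * |t - s|) * F s := by
          rw [← mul_assoc, ← Real.exp_add, abs_of_nonpos (sub_nonpos.2 h)]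
          ring_nf

namespace IsFlowOf

variable {E : Type*} [NormedAddCommGroup E] [NormedSpace ℝ E] {X : ℝ → E → E} {v : E → E}
  {K : ℝ≥0}

theorem weightedPullback_zero (hX : IsFlowOf X v) (ρ g : E → ℝ) : weightedPullback X ρ g 0 = g := by
  ext x
  simp [weightedPullback, flowIntegral, hX.map_zero]

theorem weightedPullback_le_exp_mul (hX : IsFlowOf X v) {ρ ρ' g : E → ℝ} (hρ : Continuous ρ)
    (hρ' : Continuous ρ') (hg : 0 ≤ g) {ε : ℝ} (h : ∀ x, |ρ x - ρ' x| ≤ ε) (t : ℝ) (x : E) :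
    weightedPullback X ρ g t x ≤ Real.exp (ε * |t|) * weightedPullback X ρ' g t x := by
  have hint {ρ : E → ℝ} (hρ : Continuous ρ) :
      IntervalIntegrable (fun s => ρ (X s x)) volume 0 t :=
    (hρ.comp (hX.isIntegralCurve x).continuous).intervalIntegrable 0 t
  have hdiff : flowIntegral X ρ t x - flowIntegral X ρ' t x ≤ ε * |t| := by
    rw [flowIntegral, flowIntegral, ← intervalIntegral.integral_sub (hint hρ) (hint hρ')]
    refine (le_abs_self _).trans ?_
    simpa only [sub_zero, ← Real.norm_eq_abs] using
      intervalIntegral.norm_integral_le_of_norm_le_const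
        (f := fun s => ρ (X s x) - ρ' (X s x)) (a := 0) (b := t) fun s _ => h (X s x)
  rw [weightedPullback, weightedPullback, ← mul_assoc, ← Real.exp_add]
  gcongr
  · exact hg _
  · linarith

theorem fderiv_weightedPullback_apply_add (hX : IsFlowOf X v) (hv : LipschitzWith K v)
    {ρ g : E → ℝ} (hρ : Continuous ρ) {t : ℝ} {x : E} (hg : DifferentiableAt ℝ g (X t x))
    (hgt : DifferentiableAt ℝ (weightedPullback X ρ g t) x) :
    fderiv ℝ (weightedPullback X ρ g t) x (v x) + ρ x * weightedPullback X ρ g t x =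
      weightedPullback X ρ (fun y => fderiv ℝ g y (v y) + ρ y * g y) t x := by
  -- With `g t = weightedPullback X ρ g t`, both sides are the derivative at `s = 0` of
  -- `g (t + s) x = weightedPullback X ρ (g t) s x`.
  have hpull : HasDerivAt (fun s => weightedPullback X ρ g (t + s) x)
      (weightedPullback X ρ (fun y => fderiv ℝ g y (v y) + ρ y * g y) t x) 0 := by
    have h := hX.hasDerivAt_weightedPullback hρ hg
    rw [← add_zero t] at h
    simpa using h.comp_const_add t 0
  simp only [hX.weightedPullback_add hv hρ g t] at hpull
  refine HasDerivAt.unique ?_ hpull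
  have hzero := hX.hasDerivAt_weightedPullback (t := 0) (x := x) hρ ((hX.map_zero x).symm ▸ hgt)
  rwa [hX.weightedPullback_zero] at hzero

variable [MeasurableSpace E] [BorelSpace E]

theorem integrable_weightedPullback (hX : IsFlowOf X v) (hv : LipschitzWith K v) {ρ g : E → ℝ}
    (hρ : Continuous ρ) (hg : Continuous g) (hgc : HasCompactSupport g) (μ : Measure E)
    [IsFiniteMeasureOnCompacts μ] (t : ℝ) : Integrable (weightedPullback X ρ g t) μ :=
  ((hX.continuous_weightedPullback hv hρ hg).comp (Continuous.prodMk_right t)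
    ).integrable_of_hasCompactSupport (hX.hasCompactSupport_weightedPullback hv ρ hgc t)

theorem integral_weightedPullback_le_of_abs_sub_le (hX : IsFlowOf X v) (hv : LipschitzWith K v)
    {ρ ρ' g : E → ℝ} (hρ : Continuous ρ) (hρ' : Continuous ρ') {ε : ℝ}
    (hε : ∀ x, |ρ x - ρ' x| ≤ ε) (hg : Continuous g) (hgc : HasCompactSupport g) (h0 : 0 ≤ g)
    (μ : Measure E) [IsFiniteMeasureOnCompacts μ] (t : ℝ) :
    ∫ x, weightedPullback X ρ g t x ∂μ ≤
      Real.exp (ε * |t|) * ∫ x, weightedPullback X ρ' g t x ∂μ := by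
  rw [← integral_const_mul]
  exact integral_mono (hX.integrable_weightedPullback hv hρ hg hgc μ t)
    ((hX.integrable_weightedPullback hv hρ' hg hgc μ t).const_mul _)
    (hX.weightedPullback_le_exp_mul hρ hρ' h0 hε t)

theorem hasDerivAt_integral_weightedPullback (hX : IsFlowOf X v) (hv : LipschitzWith K v)
    {ρ g : E → ℝ} (hρ : Continuous ρ) (hg : ContDiff ℝ 1 g) (hgc : HasCompactSupport g)
    (μ : Measure E) [IsFiniteMeasureOnCompacts μ] (t : ℝ) :
    HasDerivAt (fun t => ∫ x, weightedPullback X ρ g t x ∂μ)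
      (∫ x, weightedPullback X ρ (fun y => fderiv ℝ g y (v y) + ρ y * g y) t x ∂μ) t := by
  obtain ⟨k, hk, hzero⟩ := hX.exists_isCompact_weightedPullback_eq_zero hv ρ hgc
    (isCompact_closedBall t 1)
  have hgenerator : Continuous fun y => fderiv ℝ g y (v y) + ρ y * g y :=
    ((hg.continuous_fderiv one_ne_zero).clm_apply hv.continuous).add (hρ.mul hg.continuous)
  exact hasDerivAt_integral_of_continuous_of_isCompact
    (hX.continuous_weightedPullback hv hρ hg.continuous)
    (hX.continuous_weightedPullback hv hρ hgenerator)
    (fun t x => hX.hasDerivAt_weightedPullback hρ (hg.differentiable one_ne_zero _))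
    one_pos hk hzero

variable [FiniteDimensional ℝ E]

theorem integral_weightedPullback_generator (hX : IsFlowOf X v) (hv : LipschitzWith K v)
    (hv₁ : ContDiff ℝ 1 v) {ρ g : E → ℝ} (hρ : LocallyLipschitz ρ) (hg : ContDiff ℝ 1 g)
    (hgc : HasCompactSupport g) (μ : Measure E) [μ.IsAddHaarMeasure] (t : ℝ) :
    ∫ x, weightedPullback X ρ (fun y => fderiv ℝ g y (v y) + ρ y * g y) t x ∂μ =
      ∫ x, (ρ x - divergence v x) * weightedPullback X ρ g t x ∂μ := by
  have : ProperSpace E := FiniteDimensional.proper ℝ E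
  set Dg : E → ℝ := fun y => fderiv ℝ g y (v y) + ρ y * g y
  set gt := weightedPullback X ρ g t
  obtain ⟨C, hgt⟩ := hX.exists_lipschitzWith_weightedPullback hv hρ hg.locallyLipschitz hgc t
  have hgtc : HasCompactSupport gt := hX.hasCompactSupport_weightedPullback hv ρ hgc t
  have hint {f : E → ℝ} (hf : Continuous f) : Integrable (fun x => f x * gt x) μ :=
    (hf.mul hgt.continuous).integrable_of_hasCompactSupport hgtc.mul_left
  have hint_Dg : Integrable (weightedPullback X ρ Dg t) μ := by
    have hDg : Continuous Dg :=
      ((hg.continuous_fderiv one_ne_zero).clm_apply hv.continuous).add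
        (hρ.continuous.mul hg.continuous)
    have hDgc : HasCompactSupport Dg := .intro hgc fun x hx => by
      simp [Dg, image_eq_zero_of_notMem_tsupport hx, fderiv_of_notMem_tsupport ℝ hx]
    exact hX.integrable_weightedPullback hv hρ.continuous hDg hDgc μ t
  have hfderiv : ∫ x, fderiv ℝ gt x (v x) ∂μ =
      (∫ x, weightedPullback X ρ Dg t x ∂μ) - ∫ x, ρ x * gt x ∂μ := by
    rw [← integral_sub hint_Dg (hint hρ.continuous)]
    refine integral_congr_ae ?_
    filter_upwards [hgt.ae_differentiableAt] with x hx
    exact eq_sub_of_add_eq (hX.fderiv_weightedPullback_apply_add hv hρ.continuous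
      (hg.differentiable one_ne_zero _) hx)
  simp only [sub_mul]
  rw [integral_sub (hint hρ.continuous) (hint (continuous_divergence hv₁))]
  linarith [integral_fderiv_apply_eq_neg_integral_mul_divergence μ hv hgt hgtc]

theorem integral_weightedPullback_le_exp_mul (hX : IsFlowOf X v) (hv : LipschitzWith K v)
    (hv₁ : ContDiff ℝ 1 v) {ρ g : E → ℝ} (hρ : LocallyLipschitz ρ) {ε : ℝ}
    (hε : ∀ x, |ρ x - divergence v x| ≤ ε) (hg : ContDiff ℝ 1 g) (hgc : HasCompactSupport g)
    (h0 : 0 ≤ g) (μ : Measure E) [μ.IsAddHaarMeasure] (s t : ℝ) :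
    ∫ x, weightedPullback X ρ g t x ∂μ ≤
      Real.exp (ε * |t - s|) * ∫ x, weightedPullback X ρ g s x ∂μ := by
  refine le_exp_mul_of_abs_deriv_le (F := fun t => ∫ x, weightedPullback X ρ g t x ∂μ)
    (fun t => hX.hasDerivAt_integral_weightedPullback hv hρ.continuous hg hgc μ t) (fun t => ?_) s t
  have hnonneg (x : E) : 0 ≤ weightedPullback X ρ g t x := mul_nonneg (Real.exp_pos _).le (h0 _)
  have hint : Integrable (weightedPullback X ρ g t) μ :=
    hX.integrable_weightedPullback hv hρ.continuous hg.continuous hgc μ t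
  rw [hX.integral_weightedPullback_generator hv hv₁ hρ hg hgc, ← integral_const_mul]
  refine norm_integral_le_of_norm_le (f := fun x => (ρ x - divergence v x) *
    weightedPullback X ρ g t x) (hint.const_mul ε) (.of_forall fun x => ?_)
  rw [norm_mul, Real.norm_of_nonneg (hnonneg x)]
  exact mul_le_mul_of_nonneg_right (hε x) (hnonneg x)

theorem integral_weightedPullback_divergence (hX : IsFlowOf X v) (hv : LipschitzWith K v)
    (hv₁ : ContDiff ℝ 1 v) {g : E → ℝ} (hg : ContDiff ℝ 1 g) (hgc : HasCompactSupport g)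
    (h0 : 0 ≤ g) (μ : Measure E) [μ.IsAddHaarMeasure] (t : ℝ) :
    ∫ x, weightedPullback X (divergence v) g t x ∂μ = ∫ x, g x ∂μ := by
  have hdiv := continuous_divergence hv₁
  have happrox (ε : ℝ) (hε : 0 < ε) :
      ∫ x, weightedPullback X (divergence v) g t x ∂μ ≤
          Real.exp (2 * ε * |t|) * ∫ x, g x ∂μ ∧
        ∫ x, g x ∂μ ≤
          Real.exp (2 * ε * |t|) * ∫ x, weightedPullback X (divergence v) g t x ∂μ := by
    obtain ⟨ρ, hρ, hρε, -⟩ := hdiv.exists_contDiff_approx 1 (ε := fun _ => ε) continuous_const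
      fun _ => hε
    have hclose (x : E) : |ρ x - divergence v x| ≤ ε := (hρε x).le
    have hgronwall := hX.integral_weightedPullback_le_exp_mul hv hv₁ hρ.locallyLipschitz
      hclose hg hgc h0 μ
    have hexp : Real.exp (2 * ε * |t|) = Real.exp (ε * |t|) * Real.exp (ε * |t|) := by
      rw [← Real.exp_add]
      ring_nf
    rw [hexp, mul_assoc, mul_assoc]
    constructor
    · refine (hX.integral_weightedPullback_le_of_abs_sub_le hv hdiv hρ.continuous
        (fun x => abs_sub_comm (ρ x) _ ▸ hclose x) hg.continuous hgc h0 μ t).trans ?_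
      gcongr
      simpa [hX.weightedPullback_zero] using hgronwall 0 t
    · refine le_trans ?_ (mul_le_mul_of_nonneg_left
        (hX.integral_weightedPullback_le_of_abs_sub_le hv hρ.continuous hdiv hclose hg.continuous
          hgc h0 μ t) (Real.exp_pos _).le)
      simpa [hX.weightedPullback_zero] using hgronwall t 0
  have hlim (c : ℝ) : Tendsto (fun ε => Real.exp (2 * ε * |t|) * c) (𝓝[>] 0) (𝓝 c) :=
    ((by fun_prop : Continuous fun ε : ℝ => Real.exp (2 * ε * |t|) * c).tendsto' 0 c
      (by simp)).mono_left nhdsWithin_le_nhds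
  exact le_antisymm
    (ge_of_tendsto (hlim _) (eventually_mem_nhdsWithin.mono fun ε hε => (happrox ε hε).1))
    (ge_of_tendsto (hlim _) (eventually_mem_nhdsWithin.mono fun ε hε => (happrox ε hε).2))

end IsFlowOf

/-! ### Invariant densities -/

/-- The supremum over all times, negative ones included, of the integrals of `ρ` along the
trajectory `X · x`; it is meaningful when these integrals are bounded above. -/
noncomputable def supFlowIntegral {E : Type*} (X : ℝ → E → E) (ρ : E → ℝ) (x : E) : ℝ :=
  ⨆ t, flowIntegral X ρ t x

theorem supFlowIntegral_nonneg {E : Type*} {X : ℝ → E → E} {ρ : E → ℝ} {x : E}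
    (hbdd : BddAbove (range (flowIntegral X ρ · x))) : 0 ≤ supFlowIntegral X ρ x :=
  intervalIntegral.integral_same.symm.le.trans (le_ciSup hbdd 0)

theorem memLp_top_exp {α : Type*} [MeasurableSpace α] {μ : Measure α} {f : α → ℝ} {C : ℝ}
    (hf : AEMeasurable f μ) (hC : ∀ᵐ x ∂μ, f x ≤ C) : MemLp (fun x => Real.exp (f x)) ⊤ μ :=
  memLp_top_of_bound hf.exp.aestronglyMeasurable (Real.exp C) <| hC.mono fun x hx => by
    rw [Real.norm_of_nonneg (Real.exp_pos _).le]
    exact Real.exp_le_exp.2 hx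

theorem isFiniteMeasureOnCompacts_withDensity_ofReal {α : Type*} [TopologicalSpace α]
    [T2Space α] [MeasurableSpace α] [OpensMeasurableSpace α] {μ : Measure α} {σ : α → ℝ}
    (hσ : LocallyIntegrable σ μ) :
    IsFiniteMeasureOnCompacts (μ.withDensity fun x => ENNReal.ofReal (σ x)) where
  lt_top_of_isCompact k hk := by
    rw [withDensity_apply _ hk.measurableSet]
    exact (hσ.integrableOn_isCompact hk).lintegral_lt_top

theorem fderiv_apply_add_mul_divergence_eq_zero {E : Type*} [NormedAddCommGroup E]
    [NormedSpace ℝ E] [FiniteDimensional ℝ E] [MeasurableSpace E] [BorelSpace E] {μ : Measure E}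
    [μ.IsAddHaarMeasure] {v : E → E} {K : ℝ≥0} (hv : LipschitzWith K v) (hv₁ : ContDiff ℝ 1 v)
    {σ : E → ℝ} (hσ : ContDiff ℝ 1 σ)
    (h : ∀ φ : E → ℝ, ContDiff ℝ ∞ φ → HasCompactSupport φ →
      ∫ x, σ x * fderiv ℝ φ x (v x) ∂μ = 0) (x : E) :
    fderiv ℝ σ x (v x) + σ x * divergence v x = 0 := by
  have : ProperSpace E := FiniteDimensional.proper ℝ E
  have hσv : Continuous fun x => fderiv ℝ σ x (v x) :=
    (hσ.continuous_fderiv one_ne_zero).clm_apply hv.continuous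
  have hcont : Continuous fun x => fderiv ℝ σ x (v x) + σ x * divergence v x :=
    hσv.add (hσ.continuous.mul (continuous_divergence hv₁))
  refine congrFun ((hcont.ae_eq_iff_eq μ continuous_zero).1
    (ae_eq_zero_of_integral_contDiff_smul_eq_zero hcont.locallyIntegrable fun φ hφ hφc => ?_)) x
  have hφ₁ : ContDiff ℝ 1 φ := hφ.of_le (by simp)
  obtain ⟨C, hC⟩ := exists_lipschitzWith_of_hasCompactSupport (hσ.mul hφ₁).locallyLipschitz
    (hφc.mul_left (f := σ))
  have hint {f : E → ℝ} (hf : Continuous f) : Integrable (fun x => φ x * f x) μ :=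
    (hφ.continuous.mul hf).integrable_of_hasCompactSupport hφc.mul_right
  have hφv : Integrable (fun x => σ x * fderiv ℝ φ x (v x)) μ :=
    (hσ.continuous.mul ((hφ₁.continuous_fderiv one_ne_zero).clm_apply hv.continuous)
      ).integrable_of_hasCompactSupport (.intro hφc fun x hx => by
        simp [fderiv_of_notMem_tsupport ℝ hx])
  have hleibniz (x : E) : fderiv ℝ (fun y => σ y * φ y) x (v x) =
      σ x * fderiv ℝ φ x (v x) + φ x * fderiv ℝ σ x (v x) := by
    rw [fderiv_fun_mul (hσ.differentiable one_ne_zero x) (hφ₁.differentiable one_ne_zero x)]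
    rfl
  have hweak := integral_fderiv_apply_eq_neg_integral_mul_divergence μ hv hC hφc.mul_left
  simp only [hleibniz] at hweak
  rw [integral_add hφv (hint hσv), h φ hφ hφc, zero_add, eq_neg_iff_add_eq_zero] at hweak
  have hdiv : (fun x => divergence v x * (σ x * φ x)) = fun x => φ x * (σ x * divergence v x) := by
    ext x
    ring
  rw [← hweak, hdiv, ← integral_add (hint hσv)
    (hint (f := fun x => σ x * divergence v x) (hσ.continuous.mul (continuous_divergence hv₁)))]
  simp only [smul_eq_mul, mul_add]

namespace IsFlowOf

variable {E : Type*} [NormedAddCommGroup E] [NormedSpace ℝ E] {X : ℝ → E → E} {v : E → E}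
  {K : ℝ≥0} {ρ : E → ℝ}

theorem flowIntegral_eq_log_sub_log (hX : IsFlowOf X v) (hρ : Continuous ρ) {σ : E → ℝ}
    (hσ : Differentiable ℝ σ) (hpos : ∀ x, 0 < σ x)
    (h : ∀ x, fderiv ℝ σ x (v x) + σ x * ρ x = 0) (t : ℝ) (x : E) :
    flowIntegral X ρ t x = Real.log (σ x) - Real.log (σ (X t x)) := by
  have hderiv (s : ℝ) : HasDerivAt (fun s => -Real.log (σ (X s x))) (ρ (X s x)) s := by
    refine ((((hσ _).hasFDerivAt.comp_hasDerivAt s (hX.isIntegralCurve x s)).log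
      (hpos _).ne').neg).congr_deriv ?_
    simp only [Function.comp_apply]
    rw [← neg_div, div_eq_iff (hpos _).ne']
    linarith [h (X s x)]
  rw [flowIntegral, intervalIntegral.integral_eq_sub_of_hasDerivAt (fun s _ => hderiv s)
    ((hρ.comp (hX.isIntegralCurve x).continuous).intervalIntegrable 0 t), hX.map_zero]
  ring

theorem abs_flowIntegral_le_of_forall_nonneg (hX : IsFlowOf X v) (hv : LipschitzWith K v)
    (hρ : Continuous ρ) {C : ℝ} (hC : ∀ t, 0 ≤ t → ∀ x, |flowIntegral X ρ t x| ≤ C) (t : ℝ)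
    (x : E) : |flowIntegral X ρ t x| ≤ C := by
  rcases le_total 0 t with ht | ht
  · exact hC t ht x
  · have hcocycle := hX.flowIntegral_add hv hρ (-t) t x
    rw [neg_add_cancel, flowIntegral, intervalIntegral.integral_same] at hcocycle
    rw [← neg_eq_of_add_eq_zero_left hcocycle.symm, abs_neg]
    exact hC (-t) (neg_nonneg.2 ht) (X t x)

theorem supFlowIntegral_map (hX : IsFlowOf X v) (hv : LipschitzWith K v) (hρ : Continuous ρ)
    {x : E} (hbdd : BddAbove (range (flowIntegral X ρ · x))) (t : ℝ) :
    supFlowIntegral X ρ (X t x) = supFlowIntegral X ρ x - flowIntegral X ρ t x := by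
  have hcocycle (s : ℝ) : flowIntegral X ρ s (X t x) =
      flowIntegral X ρ (s + t) x - flowIntegral X ρ t x := by
    rw [hX.flowIntegral_add hv hρ, add_sub_cancel_left]
  simp only [supFlowIntegral, hcocycle]
  rw [← ciSup_sub (f := fun s => flowIntegral X ρ (s + t) x)
    (hbdd.mono (range_comp_subset_range (· + t) (flowIntegral X ρ · x)))]
  congr 1
  exact (Equiv.addRight t).surjective.iSup_comp (flowIntegral X ρ · x)

theorem supFlowIntegral_add_period (hX : IsFlowOf X v) (hv : LipschitzWith K v) {c : E}
    (hvc : Function.Periodic v c) (hρc : Function.Periodic ρ c) :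
    Function.Periodic (supFlowIntegral X ρ) c := fun x => by
  simp only [supFlowIntegral, hX.flowIntegral_add_period hv hvc hρc _ x]

theorem measurable_supFlowIntegral [MeasurableSpace E] [BorelSpace E] (hX : IsFlowOf X v)
    (hv : LipschitzWith K v) (hρ : Continuous ρ)
    (hbdd : ∀ x, BddAbove (range (flowIntegral X ρ · x))) :
    Measurable (supFlowIntegral X ρ) :=
  (lowerSemicontinuous_ciSup hbdd fun t =>
    ((hX.continuous_flowIntegral hv hρ).comp (Continuous.prodMk_right t)).lowerSemicontinuous
    ).measurable

theorem integral_fderiv_apply_eq_zero_of_measurePreserving [MeasurableSpace E] [BorelSpace E]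
    (hX : IsFlowOf X v) (hv : LipschitzWith K v) {ν : Measure E} [IsFiniteMeasureOnCompacts ν]
    (hν : ∀ t, MeasurePreserving (X t) ν ν) {φ : E → ℝ} (hφ : ContDiff ℝ 1 φ)
    (hφc : HasCompactSupport φ) : ∫ x, fderiv ℝ φ x (v x) ∂ν = 0 := by
  have hconst (t : ℝ) : ∫ x, weightedPullback X 0 φ t x ∂ν = ∫ x, φ x ∂ν := by
    simp only [weightedPullback, flowIntegral, Pi.zero_apply, intervalIntegral.integral_zero,
      Real.exp_zero, one_mul]
    rw [← integral_map (hν t).aemeasurable hφ.continuous.aestronglyMeasurable, (hν t).map_eq]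
  have hderiv := hX.hasDerivAt_integral_weightedPullback hv (ρ := 0) continuous_zero hφ hφc ν 0
  simp only [hconst, hX.weightedPullback_zero, Pi.zero_apply, zero_mul, add_zero] at hderiv
  exact hderiv.unique (hasDerivAt_const 0 _)

variable [FiniteDimensional ℝ E] [MeasurableSpace E] [BorelSpace E]

theorem map_withDensity_exp_flowIntegral_divergence (hX : IsFlowOf X v) (hv : LipschitzWith K v)
    (hv₁ : ContDiff ℝ 1 v) (μ : Measure E) [μ.IsAddHaarMeasure] (t : ℝ) :
    (μ.withDensity fun x => ENNReal.ofReal (Real.exp (flowIntegral X (divergence v) t x))).map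
      (X t) = μ := by
  have hXt : Continuous (X t) := (hX.lipschitzWith hv t).continuous
  have hexp : Continuous fun x => Real.exp (flowIntegral X (divergence v) t x) :=
    ((hX.continuous_flowIntegral hv (continuous_divergence hv₁)).comp
      (Continuous.prodMk_right t)).rexp
  set ν := μ.withDensity fun x => ENNReal.ofReal (Real.exp (flowIntegral X (divergence v) t x))
  have : IsFiniteMeasureOnCompacts ν :=
    isFiniteMeasureOnCompacts_withDensity_ofReal hexp.locallyIntegrable
  have : IsFiniteMeasureOnCompacts (ν.map (X t)) := ⟨fun k hk => by
    rw [Measure.map_apply hXt.measurable hk.measurableSet]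
    refine (measure_mono fun x hx => ?_).trans_lt
      (hk.image (hX.lipschitzWith hv (-t)).continuous).measure_lt_top
    exact ⟨X t x, hx, hX.map_neg_map hv t x⟩⟩
  refine measure_eq_of_forall_integral_contDiff_eq fun g hg hgc h0 => ?_
  rw [integral_map hXt.aemeasurable hg.continuous.aestronglyMeasurable,
    integral_withDensity_eq_integral_toReal_smul hexp.measurable.ennreal_ofReal
      (.of_forall fun _ => ENNReal.ofReal_lt_top)]
  simp only [ENNReal.toReal_ofReal (Real.exp_pos _).le, smul_eq_mul]
  exact hX.integral_weightedPullback_divergence hv hv₁ (hg.of_le (by simp)) hgc h0 μ t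

theorem measurePreserving_withDensity (hX : IsFlowOf X v) (hv : LipschitzWith K v)
    (hv₁ : ContDiff ℝ 1 v) (μ : Measure E) [μ.IsAddHaarMeasure] {σ : E → ℝ} (hσ : Measurable σ)
    {t : ℝ} (h : ∀ x, Real.exp (flowIntegral X (divergence v) t x) * σ (X t x) = σ x) :
    MeasurePreserving (X t) (μ.withDensity fun x => ENNReal.ofReal (σ x))
      (μ.withDensity fun x => ENNReal.ofReal (σ x)) := by
  have hXt : Measurable (X t) := (hX.lipschitzWith hv t).continuous.measurable
  have hexp : Measurable fun x =>
      ENNReal.ofReal (Real.exp (flowIntegral X (divergence v) t x)) :=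
    ((hX.continuous_flowIntegral hv (continuous_divergence hv₁)).comp
      (Continuous.prodMk_right t)).rexp.measurable.ennreal_ofReal
  refine ⟨hXt, Measure.ext fun s hs => ?_⟩
  rw [Measure.map_apply hXt hs, withDensity_apply _ (hXt hs), withDensity_apply _ hs]
  conv_rhs => rw [← hX.map_withDensity_exp_flowIntegral_divergence hv hv₁ μ t]
  rw [setLIntegral_map hs hσ.ennreal_ofReal hXt,
    setLIntegral_withDensity_eq_setLIntegral_mul _ hexp
      (g := fun x => ENNReal.ofReal (σ (X t x))) (hσ.ennreal_ofReal.comp hXt) (hXt hs)]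
  simp only [Pi.mul_apply, ← ENNReal.ofReal_mul (Real.exp_pos _).le, h]

theorem integral_mul_fderiv_apply_eq_zero (hX : IsFlowOf X v) (hv : LipschitzWith K v)
    (hv₁ : ContDiff ℝ 1 v) {μ : Measure E} [μ.IsAddHaarMeasure] {σ : E → ℝ} (hσ : Measurable σ)
    (hint : LocallyIntegrable σ μ) (h0 : 0 ≤ σ)
    (h : ∀ t x, Real.exp (flowIntegral X (divergence v) t x) * σ (X t x) = σ x) {φ : E → ℝ}
    (hφ : ContDiff ℝ 1 φ) (hφc : HasCompactSupport φ) :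
    ∫ x, σ x * fderiv ℝ φ x (v x) ∂μ = 0 := by
  have := isFiniteMeasureOnCompacts_withDensity_ofReal hint
  rw [← hX.integral_fderiv_apply_eq_zero_of_measurePreserving hv
    (fun t => hX.measurePreserving_withDensity hv hv₁ μ hσ (h t)) hφ hφc,
    integral_withDensity_eq_integral_toReal_smul hσ.ennreal_ofReal
      (.of_forall fun _ => ENNReal.ofReal_lt_top)]
  simp only [ENNReal.toReal_ofReal (h0 _), smul_eq_mul]

end IsFlowOf

/-! ### Gradient flows -/

section GradientFlow

variable {d : ℕ} {u σ : EuclideanSpace ℝ (Fin d) → ℝ}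

theorem isFlowOf_gradientFlow (hu : ContDiff ℝ 2 u) (hper : IsYPeriodic (∇ u)) :
    IsFlowOf (gradientFlow u) (∇ u) where
  map_zero x := (gradientFlow_spec hu hper x).1
  isIntegralCurve x := (gradientFlow_spec hu hper x).2

theorem continuous_laplacian (hu : ContDiff ℝ 2 u) : Continuous (Δ u) :=
  divergence_gradient hu ▸ continuous_divergence (contDiff_gradient hu)

theorem IsYPeriodic.laplacian (hper : IsYPeriodic (∇ u)) (hu : ContDiff ℝ 2 u) :
    IsYPeriodic (Δ u) := fun k x => by
  have hperiod : (fun y => ∇ u (y + WithLp.toLp 2 fun i => (k i : ℝ))) = ∇ u := funext (hper k)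
  rw [← divergence_gradient hu, divergence, divergence, ← fderiv_comp_add_right, hperiod]

theorem inner_gradient_gradient {F : Type*} [NormedAddCommGroup F] [InnerProductSpace ℝ F]
    [CompleteSpace F] (f g : F → ℝ) (x : F) : ⟪∇ f x, ∇ g x⟫_ℝ = fderiv ℝ g x (∇ f x) := by
  rw [real_inner_comm, gradient, InnerProductSpace.toDual_symm_apply]

theorem LaplacianIntegralsBounded.exists_isRealizableInTorusWith
    (hb : LaplacianIntegralsBounded u) (hu : ContDiff ℝ 2 u) (hper : IsYPeriodic (∇ u)) :
    ∃ σ : EuclideanSpace ℝ (Fin d) → ℝ, IsRealizableInTorusWith u σ ∧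
      MemLp σ ⊤ volume ∧ MemLp (fun x => (σ x)⁻¹) ⊤ volume := by
  have hX := isFlowOf_gradientFlow hu hper
  obtain ⟨K, hK⟩ := exists_lipschitzWith_gradient hu hper
  have hΔ := continuous_laplacian hu
  obtain ⟨C, -, hC⟩ := hb
  have hI (t x) : flowIntegral (gradientFlow u) (Δ u) t x ≤ C :=
    (le_abs_self _).trans (hX.abs_flowIntegral_le_of_forall_nonneg hK hΔ hC t x)
  have hbdd (x) : BddAbove (range (flowIntegral (gradientFlow u) (Δ u) · x)) :=
    ⟨C, forall_mem_range.2 (hI · x)⟩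
  set S := supFlowIntegral (gradientFlow u) (Δ u) with hS
  have hSm : Measurable S := hX.measurable_supFlowIntegral hK hΔ hbdd
  have hmem : MemLp (fun x => Real.exp (S x)) ⊤ volume :=
    memLp_top_exp hSm.aemeasurable (.of_forall fun x => ciSup_le (hI · x))
  have hmem_inv : MemLp (fun x => (Real.exp (S x))⁻¹) ⊤ volume := by
    simp only [← Real.exp_neg]
    exact memLp_top_exp hSm.neg.aemeasurable
      (.of_forall fun x => neg_nonpos.2 (supFlowIntegral_nonneg (hbdd x)))
  refine ⟨fun x => Real.exp (S x), ⟨fun x => Real.exp_pos _, hmem.locallyIntegrable le_top,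
    fun k => ?_, fun φ hφ hφc => ?_⟩, hmem, hmem_inv⟩
  · exact (hX.supFlowIntegral_add_period hK (hper k) (hper.laplacian hu k)).comp Real.exp
  · simp only [inner_gradient_gradient]
    refine hX.integral_mul_fderiv_apply_eq_zero hK (contDiff_gradient hu) hSm.exp
      (hmem.locallyIntegrable le_top) (fun x => (Real.exp_pos _).le) (fun t x => ?_)
      (hφ.of_le (by simp)) hφc
    rw [divergence_gradient hu, ← Real.exp_add, hS, hX.supFlowIntegral_map hK hΔ (hbdd x),
      add_sub_cancel]

theorem DivSigmaGradEqZero.fderiv_apply_gradient_add_mul_laplacian (hu : ContDiff ℝ 2 u)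
    (hper : IsYPeriodic (∇ u)) (hσ : ContDiff ℝ 1 σ) (h : DivSigmaGradEqZero σ u)
    (x : EuclideanSpace ℝ (Fin d)) : fderiv ℝ σ x (∇ u x) + σ x * Δ u x = 0 := by
  obtain ⟨K, hK⟩ := exists_lipschitzWith_gradient hu hper
  rw [← divergence_gradient hu]
  refine fderiv_apply_add_mul_divergence_eq_zero (μ := volume) hK (contDiff_gradient hu) hσ
    (fun φ hφ hφc => ?_) x
  simpa only [inner_gradient_gradient] using h φ hφ hφc

theorem IsRealizableInTorusWith.laplacianVanishesAtCriticalPoints (hu : ContDiff ℝ 2 u)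
    (hper : IsYPeriodic (∇ u)) (hσ : ContDiff ℝ 1 σ) (h : IsRealizableInTorusWith u σ) :
    LaplacianVanishesAtCriticalPoints u := fun x hx => by
  have hdiv := h.div_eq_zero.fderiv_apply_gradient_add_mul_laplacian hu hper hσ x
  rw [hx, map_zero, zero_add] at hdiv
  exact (mul_eq_zero.1 hdiv).resolve_left (h.pos x).ne'

theorem IsRealizableInTorusWith.laplacianIntegralsBounded (hu : ContDiff ℝ 2 u)
    (hper : IsYPeriodic (∇ u)) (hσ : ContDiff ℝ 1 σ) (h : IsRealizableInTorusWith u σ) :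
    LaplacianIntegralsBounded u := by
  have hlog : IsYPeriodic fun x => Real.log (σ x) := fun k => (h.periodic k).comp Real.log
  obtain ⟨C, hC⟩ := hlog.exists_norm_le (hσ.continuous.log fun x => (h.pos x).ne')
  refine ⟨C + C + 1, by positivity, fun t _ x => ?_⟩
  have hI := (isFlowOf_gradientFlow hu hper).flowIntegral_eq_log_sub_log (continuous_laplacian hu)
    (hσ.differentiable one_ne_zero) h.pos
    (h.div_eq_zero.fderiv_apply_gradient_add_mul_laplacian hu hper hσ) t x
  rw [flowIntegral] at hI
  rw [hI]
  exact (norm_sub_le _ _).trans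
    ((add_le_add (hC _) (hC _)).trans (le_add_of_nonneg_right zero_le_one))

end GradientFlow

theorem mainTheorem2_general (d : ℕ) (u : EuclideanSpace ℝ (Fin d) → ℝ) (hu : ContDiff ℝ 2 u)
    (hper : IsYPeriodic (∇ u)) :
    (LaplacianIntegralsBounded u →
      ∃ σ : EuclideanSpace ℝ (Fin d) → ℝ, IsRealizableInTorusWith u σ ∧
        MemLp σ ⊤ volume ∧ MemLp (fun x => (σ x)⁻¹) ⊤ volume) ∧
    (∀ σ : EuclideanSpace ℝ (Fin d) → ℝ, ContDiff ℝ 1 σ → IsRealizableInTorusWith u σ →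
      LaplacianVanishesAtCriticalPoints u ∧ LaplacianIntegralsBounded u) :=
  ⟨fun hb => hb.exists_isRealizableInTorusWith hu hper, fun _ hσ h =>
    ⟨h.laplacianVanishesAtCriticalPoints hu hper hσ, h.laplacianIntegralsBounded hu hper hσ⟩⟩

theorem mainTheorem2 (d : ℕ) (hd : 2 ≤ d) (u : EuclideanSpace ℝ (Fin d) → ℝ)
    (hu : ContDiff ℝ 3 u) (hper : IsYPeriodic (∇ u))
    (hbdd : ∀ᵐ x : EuclideanSpace ℝ (Fin d),
      Bornology.IsBounded ((fun t : ℝ => gradientFlow u t x) '' Set.Ici 0) ∨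
      Bornology.IsBounded ((fun t : ℝ => gradientFlow u t x) '' Set.Iic 0)) :
    (LaplacianVanishesAtCriticalPoints u → LaplacianIntegralsBounded u →
      ∃ σ : EuclideanSpace ℝ (Fin d) → ℝ, IsRealizableInTorusWith u σ ∧
        MemLp σ ⊤ volume ∧ MemLp (fun x => (σ x)⁻¹) ⊤ volume) ∧
    (∀ σ : EuclideanSpace ℝ (Fin d) → ℝ, ContDiff ℝ 1 σ → IsRealizableInTorusWith u σ →
      LaplacianVanishesAtCriticalPoints u ∧ LaplacianIntegralsBounded u) :=
  have h := mainTheorem2_general d u (hu.of_le (by norm_num)) hper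
  ⟨fun _ => h.1, h.2⟩
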